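/- For integers $m\ge 3$ and $k\ge 0$ let $F(m,k)$ be the $m$-barrel fullerene, i.e. the cubic planar graph drawn on $k+3$ concentric circles as follows. The innermost and the outermost circle are cycles of length $m$; each of the $k+1$ circles in between is a cycle of length $2m$, whose vertices are joined alternately to a vertex of the next smaller and a vertex of the next larger circle, each pair of consecutive circles being connected by $m$ edges in cyclic order. The bounded faces are thus the inner $m$-gon, a layer of $m$ pentagons, $k$ layers of $m$ hexagons, and a layer of $m$ pentagons, and the outer face is the second $m$-gon. Let $\Phi(G)$ denote the number of perfect matchings of a graph $G$. Theorem. For every $m\ge 3$ the limit $\rho(m)=\lim_{k\to\infty}\Phi(F(m,k))^{1/k}$ exists, and $$\rho(m)=\prod_{j=1}^{\lfloor (m+1)/3\rfloor}\left(2\cos\frac{\pi(2j-1)}{2m}\right)^2 .$$ -/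

import Mathlib

/-- The vertices of the `m`-barrel fullerene `F(m,k)`, drawn on `k + 3` concentric circles.
The innermost and the outermost circle carry `m` vertices each. Each of the `k + 1` circles in
between (numbered by `Fin (k + 1)`, starting from the innermost one) carries `2m` vertices, which
are, in cyclic order,
`ringIn j 0, ringOut j 0, ringIn j 1, ringOut j 1, …, ringIn j (m - 1), ringOut j (m - 1)`;
`ringIn` vertices are joined to the previous (smaller) circle and `ringOut` vertices to the next
(larger) circle. -/
inductive BarrelVertex (m k : ℕ) : Type
  | inner (l : ZMod m) : BarrelVertex m k
  | ringIn (j : Fin (k + 1)) (l : ZMod m) : BarrelVertex m k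
  | ringOut (j : Fin (k + 1)) (l : ZMod m) : BarrelVertex m k
  | outer (l : ZMod m) : BarrelVertex m k

/-- The edges of `F(m,k)`, each listed with one orientation. -/
inductive BarrelEdge (m k : ℕ) : BarrelVertex m k → BarrelVertex m k → Prop
  /-- the inner `m`-gon -/
  | innerCycle (l : ZMod m) : BarrelEdge m k (.inner l) (.inner (l + 1))
  /-- the two kinds of edges of the `j`-th `2m`-cycle -/
  | ringCycle (j : Fin (k + 1)) (l : ZMod m) : BarrelEdge m k (.ringIn j l) (.ringOut j l)
  | ringCycle' (j : Fin (k + 1)) (l : ZMod m) :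
      BarrelEdge m k (.ringOut j l) (.ringIn j (l + 1))
  /-- the outer `m`-gon -/
  | outerCycle (l : ZMod m) : BarrelEdge m k (.outer l) (.outer (l + 1))
  /-- the inner `m`-gon is joined to the first `2m`-cycle; this creates `m` pentagons -/
  | innerSpoke (l : ZMod m) : BarrelEdge m k (.inner l) (.ringIn 0 l)
  /-- consecutive `2m`-cycles are joined; this creates `k` layers of `m` hexagons -/
  | spoke (j : Fin k) (l : ZMod m) : BarrelEdge m k (.ringOut j.castSucc l) (.ringIn j.succ l)
  /-- the last `2m`-cycle is joined to the outer `m`-gon; this creates `m` pentagons -/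
  | outerSpoke (l : ZMod m) : BarrelEdge m k (.ringOut (Fin.last k) l) (.outer l)

/-- The `m`-barrel fullerene `F(m,k)` (for `m ≥ 3`). -/
def barrelFullerene (m k : ℕ) : SimpleGraph (BarrelVertex m k) :=
  SimpleGraph.fromRel (BarrelEdge m k)

/-- `Φ(G)`: the number of perfect matchings of a (finite) graph `G`. -/
noncomputable def numPerfectMatchings {V : Type*} (G : SimpleGraph V) : ℕ :=
  Nat.card {M : G.Subgraph // M.IsPerfectMatching}

/-! Cut a perfect matching along the layers of spokes and record in each layer the set `X` of
positions whose spoke is not used. Passing a ring makes each point of `X` stay or move back by one,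
without collisions, so the number of points is conserved. Hence the matchings are counted by a power
of a transfer matrix between two cap vectors (`numPerfectMatchings_eq_sum`).

The particles behave as free fermions. For `c` particles the Slater determinant of `c` consecutive
Fourier modes is, up to a constant, the product of sines of the pairwise differences: it vanishes at
collisions and, in absolute value, is a positive function on states. It is thus a Perron
eigenvector, with eigenvalue `modeProd m c` (`sum_stepCount_mul_chordProd`). Any two states of equal
size are linked within `2 * m` steps, which gives matching upper and lower bounds for the powers.

A cap matches the points of `X` in pairs, so only even `c` occur. For `c = 2 * p` the eigenvalue is
the product of the first `p` squares `(2 cos (π (2j - 1) / (2m)))²`; it is largest when exactly the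
factors at least `1` are taken, that is for `p = ⌊(m + 1) / 3⌋`. -/

/-! ### Determinants of Fourier modes. -/

/-- The product of `sin (π (x j - x i) / m)` over all `i < j`. -/
noncomputable def sinProd (m : ℕ) {c : ℕ} (x : Fin c → ℝ) : ℝ :=
  ∏ i, ∏ j ∈ Finset.Ioi i, Real.sin (Real.pi * (x j - x i) / m)

/-- The angles of `c` consecutive Fourier modes placed symmetrically about `0`. -/
noncomputable def modeAngle (m c : ℕ) (j : Fin c) : ℝ :=
  Real.pi * (2 * (j : ℝ) - ((c : ℝ) - 1)) / m

/-- The eigenvalue of the transfer operator on states with `c` particles. -/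
noncomputable def modeProd (m c : ℕ) : ℝ :=
  ∏ j : Fin c, 2 * Real.cos (modeAngle m c j / 2)

-- With `w i = exp (iπ x i / m)`, pulling `w i ^ (-(c - 1))` out of each row leaves a Vandermonde
-- matrix in the squares `w i ^ 2`. Each difference `w j ^ 2 - w i ^ 2` is `w i * w j` times `2i`
-- times a sine, and the factors `w i * w j` cancel what was pulled out.
open Finset in
theorem det_exp_modeAngle (m : ℕ) {c : ℕ} (x : Fin c → ℝ) :
    (Matrix.of fun i j : Fin c => Complex.exp (modeAngle m c j * x i * Complex.I)).det
      = (∏ i : Fin c, ∏ _j ∈ Ioi i, 2 * Complex.I) * (sinProd m x : ℂ) := by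
  set w : Fin c → ℂ := fun i => Complex.exp (Real.pi * x i / m * Complex.I) with hw
  have hw0 : ∀ i, w i ≠ 0 := fun i => Complex.exp_ne_zero _
  have h1 : (Matrix.of fun i j : Fin c => Complex.exp (modeAngle m c j * x i * Complex.I))
      = Matrix.of fun i j => (w i ^ (c - 1))⁻¹ * (Matrix.vandermonde fun i => w i ^ 2) i j := by
    ext i j
    have hc : 1 ≤ c := by have := j.2; omega
    simp only [Matrix.of_apply, Matrix.vandermonde_apply, hw, ← Complex.exp_nat_mul,
      ← Complex.exp_neg, ← Complex.exp_add]
    congr 1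
    push_cast [modeAngle, Nat.cast_sub hc]
    ring
  have h2 : ∀ i j, w j ^ 2 - w i ^ 2 =
      (w i * w j) * ((2 * Complex.I) * (Real.sin (Real.pi * (x j - x i) / m) : ℂ)) := by
    intro i j
    have : (Real.sin (Real.pi * (x j - x i) / m) : ℂ)
        = (w i / w j - w j / w i) * Complex.I / 2 := by
      simp only [hw, ← Complex.exp_sub, Complex.ofReal_sin, Complex.sin]
      push_cast
      congr 4 <;> ring_nf
    rw [this]
    have := hw0 i
    have := hw0 j
    field_simp
    rw [Complex.I_sq]
    ring
  have h3 : ∏ i, ∏ j ∈ Ioi i, (w i * w j) = ∏ i, w i ^ (c - 1) := by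
    have := prod_prod_Ioi_mul_eq_prod_prod_off_diag (fun _ i : Fin c => w i)
    rw [show (∏ i, ∏ j ∈ Ioi i, (w i * w j)) = _ from this]
    simp [card_compl]
  rw [h1, Matrix.det_mul_column, Matrix.det_vandermonde]
  have h4 : ∏ i, ∏ j ∈ Ioi i, (w j ^ 2 - w i ^ 2) = (∏ i, ∏ j ∈ Ioi i, (w i * w j)) *
      ((∏ i : Fin c, ∏ _j ∈ Ioi i, 2 * Complex.I) * (sinProd m x : ℂ)) := by
    simp only [h2, sinProd, Complex.ofReal_prod]
    simp_rw [← prod_mul_distrib]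
  rw [h4, h3, prod_inv_distrib,
    inv_mul_cancel_left₀ (prod_ne_zero_iff.2 fun i _ => pow_ne_zero _ (hw0 i))]

theorem sum_modeAngle (m c : ℕ) : ∑ j, modeAngle m c j = 0 := by
  have h : ∑ j, modeAngle m c j = ∑ j, -modeAngle m c j := by
    rw [← Equiv.sum_comp Fin.revPerm]
    refine Finset.sum_congr rfl fun j _ => ?_
    have hj := j.2
    simp only [modeAngle, Fin.revPerm_apply, Fin.val_rev]
    rw [Nat.cast_sub (by omega)]
    push_cast
    ring
  rw [Finset.sum_neg_distrib] at h
  linarith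

/-- Each factor is `exp (-iθ/2) * 2 cos (θ/2)`; the phases cancel because the angles are symmetric
about `0`. -/
theorem prod_one_add_exp_modeAngle (m c : ℕ) :
    ∏ j, (1 + Complex.exp (-(modeAngle m c j) * Complex.I)) = (modeProd m c : ℂ) := by
  have h : ∀ j, 1 + Complex.exp (-(modeAngle m c j) * Complex.I)
      = Complex.exp (-(modeAngle m c j / 2) * Complex.I)
        * ((2 * Real.cos (modeAngle m c j / 2) : ℝ) : ℂ) := by
    intro j
    push_cast
    rw [Complex.cos, mul_div_cancel₀ _ two_ne_zero, mul_add, ← Complex.exp_add,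
      ← Complex.exp_add, ← Complex.exp_zero]
    congr 2 <;> ring
  simp only [h, Finset.prod_mul_distrib, ← Complex.exp_sum, ← Finset.sum_mul]
  rw [Finset.sum_neg_distrib, ← Finset.sum_div, ← Complex.ofReal_sum, sum_modeAngle]
  simp [modeProd]

/-- `sinProd` is an eigenfunction: summing over all ways of moving some of the points back by `1`
multiplies it by `modeProd`. -/
theorem sum_sinProd_piecewise (m : ℕ) {c : ℕ} (x : Fin c → ℝ) :
    ∑ s : Finset (Fin c), sinProd m (s.piecewise x fun i => x i - 1)
      = modeProd m c * sinProd m x := by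
  have hK : (∏ i : Fin c, ∏ _j ∈ Finset.Ioi i, 2 * Complex.I) ≠ 0 :=
    Finset.prod_ne_zero_iff.2 fun i _ => Finset.prod_ne_zero_iff.2 fun j _ =>
      mul_ne_zero two_ne_zero Complex.I_ne_zero
  let r : (Fin c → ℝ) → Fin c → Fin c → ℂ := fun x i j =>
    Complex.exp (modeAngle m c j * x i * Complex.I)
  -- Multilinearity in the rows: the determinant with rows `r (x i) + r (x i - 1)` expands over all
  -- subsets of rows. Moving a point back multiplies column `j` by a phase, so the same determinant
  -- is a column rescaling of the original one.
  have h1 := (Matrix.detRowAlternating (n := Fin c) (R := ℂ)).map_add_univ (r x)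
    (r fun i => x i - 1)
  have h2 : ∀ s : Finset (Fin c), s.piecewise (r x) (r fun i => x i - 1)
      = r (s.piecewise x fun i => x i - 1) := by
    intro s
    funext i j
    by_cases h : i ∈ s <;> simp [r, h]
  have h3 : r x + (r fun i => x i - 1)
      = fun i j => (1 + Complex.exp (-(modeAngle m c j) * Complex.I)) * r x i j := by
    funext i j
    simp only [r, Pi.add_apply, add_mul, one_mul, ← Complex.exp_add]
    congr 2
    push_cast
    ring
  have h4 : ∀ x, Matrix.detRowAlternating (r x)
      = (∏ i : Fin c, ∏ _j ∈ Finset.Ioi i, 2 * Complex.I) * (sinProd m x : ℂ) :=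
    fun x => det_exp_modeAngle m x
  have h5 : Matrix.detRowAlternating
      (fun i j => (1 + Complex.exp (-(modeAngle m c j) * Complex.I)) * r x i j)
      = (modeProd m c : ℂ) * Matrix.detRowAlternating (r x) := by
    rw [← prod_one_add_exp_modeAngle]
    exact Matrix.det_mul_row _ _
  rw [h3, h5] at h1
  simp only [h2, h4, ← Finset.mul_sum] at h1
  rw [mul_left_comm] at h1
  have := mul_left_cancel₀ hK h1
  exact_mod_cast this.symm

/-! ### Matching rules at rings and caps. -/

/-- Passing a ring of length `2m`: `X` is the set of inward positions not matched inwards, `Y` the set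
of outward positions not matched outwards; `A` and `B` are the sets of selected ring edges of the two
kinds. -/
def IsStep {m : ℕ} (X Y A B : Finset (ZMod m)) : Prop :=
  (∀ l, l ∈ X ↔ l ∈ A ∨ l - 1 ∈ B) ∧ (∀ l, ¬(l ∈ A ∧ l - 1 ∈ B)) ∧
    (∀ l, l ∈ Y ↔ l ∈ A ∨ l ∈ B) ∧ ∀ l, ¬(l ∈ A ∧ l ∈ B)

/-- `P` selects edges of an `m`-cycle that match exactly the vertices in `X`. -/
def IsCap {m : ℕ} (X P : Finset (ZMod m)) : Prop :=
  (∀ l, l ∈ X ↔ l ∈ P ∨ l - 1 ∈ P) ∧ ∀ l, ¬(l ∈ P ∧ l - 1 ∈ P)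

/-- The number of ways of passing a ring from state `X` to state `Y`. -/
noncomputable def stepCount {m : ℕ} (X Y : Finset (ZMod m)) : ℕ :=
  Nat.card {E : Finset (ZMod m) × Finset (ZMod m) // IsStep X Y E.1 E.2}

/-- The number of ways of matching `X` inside an `m`-cycle. -/
noncomputable def capCount {m : ℕ} (X : Finset (ZMod m)) : ℕ :=
  Nat.card {P : Finset (ZMod m) // IsCap X P}

/-- `X` is the disjoint union of `A` and the translate `B + d`. -/
theorem card_eq_add_of_mem_iff {m : ℕ} {X A B : Finset (ZMod m)} (d : ZMod m)
    (h : ∀ l, l ∈ X ↔ l ∈ A ∨ l - d ∈ B) (h' : ∀ l, ¬(l ∈ A ∧ l - d ∈ B)) :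
    X.card = A.card + B.card := by
  have hX : X = A ∪ B.map (addRightEmbedding d) := by
    ext l
    rw [h, Finset.mem_union, Finset.mem_map]
    refine or_congr_right ⟨fun hl => ⟨l - d, hl, by simp⟩, ?_⟩
    rintro ⟨a, ha, rfl⟩
    simpa using ha
  rw [hX, Finset.card_union_of_disjoint, Finset.card_map]
  rw [Finset.disjoint_left]
  intro l hl hl'
  obtain ⟨a, ha, rfl⟩ := Finset.mem_map.1 hl'
  exact h' _ ⟨hl, by simpa using ha⟩

theorem IsStep.card_eq {m : ℕ} {X Y A B : Finset (ZMod m)} (h : IsStep X Y A B) :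
    X.card = Y.card := by
  rw [card_eq_add_of_mem_iff 1 h.1 h.2.1,
    card_eq_add_of_mem_iff (X := Y) (A := A) (B := B) 0 (by simpa using h.2.2.1)
      (by simpa using h.2.2.2)]

theorem IsCap.even_card {m : ℕ} {X P : Finset (ZMod m)} (h : IsCap X P) : Even X.card :=
  ⟨P.card, card_eq_add_of_mem_iff 1 h.1 h.2⟩

/-! ### Ring passages as moves of non-colliding particles. -/

section Moves

variable {m : ℕ} {ι : Type*} [Fintype ι] [DecidableEq ι] {x : ι → ZMod m}

/-- The particles outside `s` move back by one step. -/
def moveBack (x : ι → ZMod m) (s : Finset ι) : ι → ZMod m := s.piecewise x fun i => x i - 1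

theorem isStep_moveBack (hx : Function.Injective x) {s : Finset ι}
    (hs : Function.Injective (moveBack x s)) :
    IsStep (Finset.univ.image x) (Finset.univ.image (moveBack x s)) (s.image x)
      (sᶜ.image fun i => x i - 1) := by
  refine ⟨fun l => ?_, fun l => ?_, fun l => ?_, fun l => ?_⟩
  · simp only [Finset.mem_image, Finset.mem_univ, true_and, Finset.mem_compl, sub_left_inj]
    constructor
    · rintro ⟨i, hi⟩
      by_cases h : i ∈ s
      exacts [.inl ⟨i, h, hi⟩, .inr ⟨i, h, hi⟩]
    · rintro (⟨i, -, hi⟩ | ⟨i, -, hi⟩) <;> exact ⟨i, hi⟩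
  · simp only [Finset.mem_image, Finset.mem_compl, sub_left_inj]
    rintro ⟨⟨i, hi, rfl⟩, ⟨j, hj, h⟩⟩
    exact hj (hx h ▸ hi)
  · simp only [Finset.mem_image, Finset.mem_univ, true_and, Finset.mem_compl]
    constructor
    · rintro ⟨i, hi⟩
      by_cases h : i ∈ s
      · exact .inl ⟨i, h, by simpa [moveBack, h] using hi⟩
      · exact .inr ⟨i, h, by simpa [moveBack, h] using hi⟩
    · rintro (⟨i, h, hi⟩ | ⟨i, h, hi⟩) <;> exact ⟨i, by simpa [moveBack, h] using hi⟩
  · simp only [Finset.mem_image, Finset.mem_compl]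
    rintro ⟨⟨i, hi, rfl⟩, ⟨j, hj, h⟩⟩
    refine hj ((hs (?_ : moveBack x s j = moveBack x s i)) ▸ hi)
    simpa [moveBack, hi, hj] using h

/-- The particles that stay are those sitting on `A`. A staying and a moving particle that met would
put a point in both `A` and `B`, which the condition at the outward vertices forbids. -/
theorem exists_moveBack_of_isStep (hx : Function.Injective x) {Y A B : Finset (ZMod m)}
    (h : IsStep (Finset.univ.image x) Y A B) :
    ∃ s : Finset ι, Function.Injective (moveBack x s) ∧ Finset.univ.image (moveBack x s) = Y ∧
      s.image x = A ∧ (sᶜ.image fun i => x i - 1) = B := by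
  classical
  obtain ⟨h1, h2, h3, h4⟩ := h
  have hA : ∀ l ∈ A, ∃ i, x i = l := fun l hl => by simpa using (h1 l).2 (.inl hl)
  have hB : ∀ l ∈ B, ∃ i, x i - 1 = l := fun l hl => by
    obtain ⟨i, hi⟩ : ∃ i, x i = l + 1 := by simpa using (h1 (l + 1)).2 (.inr (by simpa using hl))
    exact ⟨i, by rw [hi]; ring⟩
  have hn : ∀ i, x i ∉ A → x i - 1 ∈ B := fun i hi =>
    ((h1 (x i)).1 (by simp)).resolve_left hi
  have eA : (Finset.univ.filter fun i => x i ∈ A).image x = A := by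
    ext l
    simp only [Finset.mem_image, Finset.mem_filter, Finset.mem_univ, true_and]
    refine ⟨?_, fun hl => ?_⟩
    · rintro ⟨i, hi, rfl⟩
      exact hi
    · obtain ⟨i, rfl⟩ := hA l hl
      exact ⟨i, hl, rfl⟩
  have eB : ((Finset.univ.filter fun i => x i ∈ A)ᶜ.image fun i => x i - 1) = B := by
    ext l
    simp only [Finset.mem_image, Finset.mem_compl, Finset.mem_filter, Finset.mem_univ, true_and]
    refine ⟨?_, fun hl => ?_⟩
    · rintro ⟨i, hi, rfl⟩
      exact hn i hi
    · obtain ⟨i, rfl⟩ := hB l hl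
      exact ⟨i, fun hi => h2 _ ⟨hi, hl⟩, rfl⟩
  have hinj : Function.Injective (moveBack x (Finset.univ.filter fun i => x i ∈ A)) := by
    intro i j hij
    by_cases hi : x i ∈ A <;> by_cases hj : x j ∈ A <;> simp [moveBack, hi, hj] at hij
    · exact hx hij
    · exact absurd ⟨hi, hij ▸ hn j hj⟩ (h4 (x i))
    · exact absurd ⟨hj, hij ▸ hn i hi⟩ (h4 (x j))
    · exact hx hij
  refine ⟨_, hinj, ?_, eA, eB⟩
  have := isStep_moveBack hx hinj
  ext l
  rw [this.2.2.1, h3, eA, eB]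

end Moves

theorem stepCount_pos_of_moveBack {m : ℕ} [NeZero m] {ι : Type*} [Fintype ι] [DecidableEq ι]
    {x : ι → ZMod m} (hx : Function.Injective x) {s : Finset ι}
    (hs : Function.Injective (moveBack x s)) :
    0 < stepCount (Finset.univ.image x) (Finset.univ.image (moveBack x s)) :=
  Nat.card_pos_iff.2 ⟨⟨⟨(_, _), isStep_moveBack hx hs⟩⟩, inferInstance⟩

theorem card_eq_of_stepCount_ne_zero {m : ℕ} {X Y : Finset (ZMod m)} (h : stepCount X Y ≠ 0) :
    X.card = Y.card := by
  obtain ⟨⟨⟨E, hE⟩⟩, -⟩ := Nat.card_pos_iff.1 (Nat.pos_of_ne_zero h)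
  exact hE.card_eq

theorem even_card_of_capCount_ne_zero {m : ℕ} {X : Finset (ZMod m)} (h : capCount X ≠ 0) :
    Even X.card := by
  obtain ⟨⟨⟨P, hP⟩⟩, -⟩ := Nat.card_pos_iff.1 (Nat.pos_of_ne_zero h)
  exact hP.even_card

/-- Summing over the states reachable in one step amounts to summing over all collision-free
moves. -/
theorem sum_stepCount_mul {m : ℕ} [NeZero m] {ι : Type*} [Fintype ι] [DecidableEq ι]
    {x : ι → ZMod m} (hx : Function.Injective x) (w : Finset (ZMod m) → ℝ)
    [DecidablePred fun s : Finset ι => Function.Injective (moveBack x s)] :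
    ∑ Y, (stepCount (Finset.univ.image x) Y : ℝ) * w Y
      = ∑ s : Finset ι with Function.Injective (moveBack x s),
          w (Finset.univ.image (moveBack x s)) := by
  classical
  have h1 : ∀ Y, (stepCount (Finset.univ.image x) Y : ℝ) * w Y
      = ∑ E : Finset (ZMod m) × Finset (ZMod m),
          if IsStep (Finset.univ.image x) Y E.1 E.2 then w Y else 0 := by
    intro Y
    rw [← Finset.sum_filter, Finset.sum_const, nsmul_eq_mul, stepCount, Nat.card_eq_fintype_card,
      Fintype.card_subtype]
  simp only [h1]
  rw [← Fintype.sum_prod_type', ← Finset.sum_filter]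
  symm
  refine Finset.sum_bij (fun s _ => (Finset.univ.image (moveBack x s), s.image x,
    sᶜ.image fun i => x i - 1)) ?_ ?_ ?_ ?_
  · intro s hs
    simpa using isStep_moveBack hx (by simpa using hs)
  · intro s _ t _ hst
    exact Finset.image_injective hx (Prod.mk.inj (Prod.mk.inj hst).2).1
  · rintro ⟨Y, A, B⟩ h
    obtain ⟨s, hs, rfl, rfl, rfl⟩ := exists_moveBack_of_isStep hx (by simpa using h)
    exact ⟨s, by simpa using hs, rfl⟩
  · intro s _
    rfl

/-! ### The Perron eigenvector. -/

/-- `|sin (π a / m)|`, proportional to the distance of `0` and `a` on a regular `m`-gon. -/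
noncomputable def chord {m : ℕ} (a : ZMod m) : ℝ := |Real.sin (Real.pi * a.val / m)|

theorem chord_intCast {m : ℕ} [NeZero m] (n : ℤ) :
    chord (n : ZMod m) = |Real.sin (Real.pi * n / m)| := by
  have hm : (m : ℝ) ≠ 0 := Nat.cast_ne_zero.2 (NeZero.ne m)
  have h : (n : ℝ) = ((n : ZMod m).val : ℝ) + m * ((n / m : ℤ) : ℝ) := by
    have h1 := Int.emod_add_mul_ediv n m
    rw [← ZMod.val_intCast] at h1
    exact_mod_cast h1.symm
  have h2 : Real.pi * n / m
      = Real.pi * (n : ZMod m).val / m + ((n / m : ℤ) : ℝ) * Real.pi := by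
    rw [h]
    field_simp
  rw [h2, Real.sin_add_int_mul_pi, abs_mul, abs_zpow, abs_neg, abs_one, one_zpow, one_mul, chord]

theorem chord_pos {m : ℕ} [NeZero m] {a : ZMod m} (ha : a ≠ 0) : 0 < chord a := by
  have hm : (0 : ℝ) < m := Nat.cast_pos.2 (NeZero.pos m)
  have h1 : (0 : ℝ) < a.val := Nat.cast_pos.2 (Nat.pos_of_ne_zero ((ZMod.val_ne_zero a).2 ha))
  have h2 : (a.val : ℝ) < m := Nat.cast_lt.2 (ZMod.val_lt a)
  refine abs_pos.2 (Real.sin_pos_of_pos_of_lt_pi (by positivity) ?_).ne'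
  rw [div_lt_iff₀ hm]
  exact mul_lt_mul_of_pos_left h2 Real.pi_pos

/-- The product of the chords between the points of `X`: the Perron eigenvector. -/
noncomputable def chordProd {m : ℕ} (X : Finset (ZMod m)) : ℝ :=
  √(∏ p ∈ X.offDiag, chord (p.1 - p.2))

theorem chordProd_pos {m : ℕ} [NeZero m] (X : Finset (ZMod m)) : 0 < chordProd X :=
  Real.sqrt_pos.2 (Finset.prod_pos fun _ hp =>
    chord_pos (sub_ne_zero.2 (Finset.mem_offDiag.1 hp).2.2))

theorem chordProd_le_one {m : ℕ} (X : Finset (ZMod m)) : chordProd X ≤ 1 :=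
  Real.sqrt_le_one.2 (Finset.prod_le_one (fun _ _ => abs_nonneg _)
    fun _ _ => Real.abs_sin_le_one _)

/-- `chordProd` runs over ordered pairs, so each chord occurs twice and the square root removes the
repetition. The result is independent of the order and of the lifts, unlike the sign of `sinProd`.
-/
theorem chordProd_image_intCast {m c : ℕ} [NeZero m] {x : Fin c → ℤ}
    (hx : Function.Injective fun i => (x i : ZMod m)) :
    chordProd (Finset.univ.image fun i => (x i : ZMod m)) = |sinProd m fun i => (x i : ℝ)| := by
  rw [chordProd, ← Real.sqrt_sq_eq_abs]
  congr 1
  have h1 : (Finset.univ.image fun i => (x i : ZMod m)).offDiag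
      = (Finset.univ : Finset (Fin c)).offDiag.image
        fun p => ((x p.1 : ZMod m), (x p.2 : ZMod m)) := by
    ext ⟨a, b⟩
    simp only [Finset.mem_offDiag, Finset.mem_image, Finset.mem_univ, true_and, Prod.mk.injEq,
      Prod.exists]
    constructor
    · rintro ⟨⟨i, rfl⟩, ⟨j, rfl⟩, h⟩
      exact ⟨i, j, fun hij => h (hij ▸ rfl), rfl, rfl⟩
    · rintro ⟨i, j, h, rfl, rfl⟩
      exact ⟨⟨i, rfl⟩, ⟨j, rfl⟩, fun hij => h (hx hij)⟩
  rw [h1, Finset.prod_image]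
  swap
  · rintro ⟨i, j⟩ _ ⟨i', j'⟩ _ h
    exact Prod.ext (hx (Prod.mk.inj h).1) (hx (Prod.mk.inj h).2)
  have h2 : ∀ i j, chord ((x i : ZMod m) - (x j : ZMod m))
      = |Real.sin (Real.pi * ((x i : ℝ) - x j) / m)| := by
    intro i j
    rw [← Int.cast_sub, chord_intCast, Int.cast_sub]
  simp only [h2]
  have h3 : (Finset.univ : Finset (Fin c)).offDiag
      = Finset.univ.filter fun p : Fin c × Fin c => p.2 ∈ ({p.1} : Finset (Fin c))ᶜ := by
    ext ⟨i, j⟩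
    simp [eq_comm]
  rw [h3, Finset.prod_filter, Fintype.prod_prod_type]
  simp only [← Finset.prod_filter, Finset.filter_mem_eq_inter, Finset.univ_inter]
  have h4 := Finset.prod_prod_Ioi_mul_eq_prod_prod_off_diag
    (fun j i : Fin c => |Real.sin (Real.pi * ((x i : ℝ) - x j) / m)|)
  rw [← h4, ← sq_abs, sinProd, Finset.abs_prod]
  simp only [Finset.abs_prod, Finset.prod_mul_distrib, sq]
  rw [mul_comm]
  congr 1
  refine Finset.prod_congr rfl fun i _ => Finset.prod_congr rfl fun j _ => ?_
  rw [← abs_neg, ← Real.sin_neg]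
  congr 2
  ring

theorem sinProd_eq_zero {m c : ℕ} [NeZero m] {x : Fin c → ℤ}
    (hx : ¬ Function.Injective fun i => (x i : ZMod m)) : sinProd m (fun i => (x i : ℝ)) = 0 := by
  have hm : (m : ℝ) ≠ 0 := Nat.cast_ne_zero.2 (NeZero.ne m)
  have key : ∀ i j, i < j → (x i : ZMod m) = x j → sinProd m (fun i => (x i : ℝ)) = 0 := by
    intro i j hij h
    refine Finset.prod_eq_zero (Finset.mem_univ i)
      (Finset.prod_eq_zero (Finset.mem_Ioi.2 hij) ?_)
    obtain ⟨d, hd⟩ := (ZMod.intCast_eq_intCast_iff_dvd_sub _ _ _).1 h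
    have hd' : (x j : ℝ) - x i = m * d := by exact_mod_cast hd
    rw [hd', Real.sin_eq_zero_iff]
    exact ⟨d, by field_simp⟩
  simp only [Function.Injective, not_forall] at hx
  obtain ⟨i, j, h, hij⟩ := hx
  rcases lt_or_gt_of_ne hij with h' | h'
  exacts [key i j h' h, key j i h' h.symm]

theorem sinProd_nonneg {m c : ℕ} [NeZero m] {x : Fin c → ℝ}
    (hx : ∀ i j, i < j → 0 ≤ x j - x i ∧ x j - x i ≤ m) : 0 ≤ sinProd m x := by
  have hm : (0 : ℝ) < m := Nat.cast_pos.2 (NeZero.pos m)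
  refine Finset.prod_nonneg fun i _ => Finset.prod_nonneg fun j hj => ?_
  obtain ⟨h1, h2⟩ := hx i j (Finset.mem_Ioi.1 hj)
  refine Real.sin_nonneg_of_nonneg_of_le_pi
    (div_nonneg (mul_nonneg Real.pi_pos.le h1) hm.le) ?_
  rw [div_le_iff₀ hm]
  exact mul_le_mul_of_nonneg_left h2 Real.pi_pos.le

theorem injective_intCast_of_strictMono {m c : ℕ} {x : Fin c → ℤ} (hx : StrictMono x)
    (hm : ∀ i j, x i < x j + m) : Function.Injective fun i => (x i : ZMod m) := by
  intro i j h
  have h1 : x j - x i = 0 := Int.eq_zero_of_abs_lt_dvd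
    ((ZMod.intCast_eq_intCast_iff_dvd_sub _ _ _).1 h)
    (abs_lt.2 ⟨by linarith [hm i j], by linarith [hm j i]⟩)
  exact hx.injective (by linarith)

theorem exists_strictMono_intCast {m : ℕ} [NeZero m] (X : Finset (ZMod m)) :
    ∃ x : Fin X.card → ℤ, StrictMono x ∧ (∀ i, 0 ≤ x i ∧ x i < m) ∧
      Finset.univ.image (fun i => (x i : ZMod m)) = X := by
  have hc : (X.image ZMod.val).card = X.card :=
    Finset.card_image_of_injective _ (ZMod.val_injective m)
  let e := (X.image ZMod.val).orderEmbOfFin hc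
  have he : ∀ i, ∃ a ∈ X, a.val = e i := fun i =>
    Finset.mem_image.1 (Finset.orderEmbOfFin_mem _ hc i)
  refine ⟨fun i => e i, fun i j hij => Int.ofNat_lt.2 (e.strictMono hij), fun i => ?_, ?_⟩
  · obtain ⟨a, -, ha⟩ := he i
    exact ⟨Int.natCast_nonneg _, Int.ofNat_lt.2 (ha ▸ ZMod.val_lt a)⟩
  · ext a
    simp only [Finset.mem_image, Finset.mem_univ, true_and]
    constructor
    · rintro ⟨i, rfl⟩
      obtain ⟨b, hb, h⟩ := he i
      rw [← h]
      simpa using hb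
    · intro ha
      have : a.val ∈ Set.range e := by
        rw [Finset.range_orderEmbOfFin]
        exact Finset.mem_coe.2 (Finset.mem_image_of_mem _ ha)
      obtain ⟨i, hi⟩ := this
      exact ⟨i, by rw [hi]; simp⟩

theorem sum_stepCount_mul_chordProd {m : ℕ} [NeZero m] (X : Finset (ZMod m)) :
    ∑ Y, (stepCount X Y : ℝ) * chordProd Y = modeProd m X.card * chordProd X := by
  classical
  obtain ⟨x, hmono, hx, hX⟩ := exists_strictMono_intCast X
  generalize X.card = c at x hmono hx hX
  subst hX
  have hinj : Function.Injective fun i => (x i : ZMod m) :=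
    injective_intCast_of_strictMono hmono fun i j => by linarith [hx i, hx j]
  -- The lifts lie in `[0, m - 1]` with gaps at least `1`, so after any move all differences lie in
  -- `[0, m]` and no sine is negative. The terms therefore add up without signs, even when a
  -- particle wraps around.
  have hpos : ∀ s : Finset (Fin c),
      0 ≤ sinProd m (s.piecewise (fun i => (x i : ℝ)) fun i => (x i : ℝ) - 1) := by
    intro s
    refine sinProd_nonneg fun i j hij => ?_
    have h1 : (x i : ℝ) + 1 ≤ x j := by exact_mod_cast hmono hij
    have h2 : (x j : ℝ) + 1 ≤ m := by exact_mod_cast (hx j).2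
    have h3 : (0 : ℝ) ≤ x i := by exact_mod_cast (hx i).1
    by_cases hi : i ∈ s <;> by_cases hj : j ∈ s <;>
      simp only [Finset.piecewise, hi, hj, if_true, if_false] <;> constructor <;> linarith
  have hcast : ∀ s : Finset (Fin c), moveBack (fun i => (x i : ZMod m)) s
      = fun i => ((s.piecewise x (fun i => x i - 1) i : ℤ) : ZMod m) := by
    intro s
    funext i
    by_cases h : i ∈ s <;> simp [moveBack, h]
  have hcast' : ∀ s : Finset (Fin c), s.piecewise (fun i => (x i : ℝ)) (fun i => (x i : ℝ) - 1)
      = fun i => ((s.piecewise x (fun i => x i - 1) i : ℤ) : ℝ) := by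
    intro s
    funext i
    by_cases h : i ∈ s <;> simp [h]
  rw [sum_stepCount_mul hinj, chordProd_image_intCast hinj]
  -- The case where every particle stays, giving the sign of `sinProd` at `x` itself.
  have h0 := hpos Finset.univ
  rw [Finset.piecewise_univ] at h0
  rw [abs_of_nonneg h0, ← sum_sinProd_piecewise, Finset.sum_filter]
  refine Finset.sum_congr rfl fun s _ => ?_
  split_ifs with h
  · rw [hcast] at h ⊢
    rw [chordProd_image_intCast h, ← hcast', abs_of_nonneg (hpos s)]
  -- Colliding moves belong to the determinantal sum but contribute zero.
  · rw [hcast] at h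
    rw [hcast', sinProd_eq_zero h]

/-! ### Growth of the powers of the transfer matrix. -/

/-- The transfer matrix between the states of consecutive layers of spokes. -/
noncomputable def transferMatrix (m : ℕ) : Matrix (Finset (ZMod m)) (Finset (ZMod m)) ℝ :=
  Matrix.of fun X Y => (stepCount X Y : ℝ)

section Transfer

variable {m : ℕ} [NeZero m]

theorem transferMatrix_pow_nonneg (n : ℕ) (X Y : Finset (ZMod m)) :
    0 ≤ (transferMatrix m ^ n) X Y := by
  induction n generalizing Y with
  | zero =>
    rw [pow_zero, Matrix.one_apply]
    split_ifs <;> norm_num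
  | succ n ih =>
    rw [pow_succ, Matrix.mul_apply]
    exact Finset.sum_nonneg fun Z _ => mul_nonneg (ih Z) (Nat.cast_nonneg _)

theorem transferMatrix_pow_mul_le (a b : ℕ) (X Y Z : Finset (ZMod m)) :
    (transferMatrix m ^ a) X Y * (transferMatrix m ^ b) Y Z ≤ (transferMatrix m ^ (a + b)) X Z := by
  rw [pow_add, Matrix.mul_apply]
  exact Finset.single_le_sum (f := fun Y => (transferMatrix m ^ a) X Y * (transferMatrix m ^ b) Y Z)
    (fun Y _ => mul_nonneg (transferMatrix_pow_nonneg a X Y)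
    (transferMatrix_pow_nonneg b Y Z)) (Finset.mem_univ Y)

theorem card_eq_of_transferMatrix_pow_ne_zero {n : ℕ} {X Y : Finset (ZMod m)}
    (h : (transferMatrix m ^ n) X Y ≠ 0) : X.card = Y.card := by
  induction n generalizing Y with
  | zero =>
    rw [pow_zero, Matrix.one_apply] at h
    exact congrArg _ (by simpa using h)
  | succ n ih =>
    rw [pow_succ, Matrix.mul_apply] at h
    obtain ⟨Z, -, hZ⟩ := Finset.exists_ne_zero_of_sum_ne_zero h
    exact (ih (left_ne_zero_of_mul hZ)).trans
      (card_eq_of_stepCount_ne_zero (Nat.cast_ne_zero.1 (right_ne_zero_of_mul hZ)))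

theorem sum_transferMatrix_pow_mul_chordProd (n : ℕ) (X : Finset (ZMod m)) :
    ∑ Y, (transferMatrix m ^ n) X Y * chordProd Y = modeProd m X.card ^ n * chordProd X := by
  induction n with
  | zero => simp [Matrix.one_apply]
  | succ n ih =>
    simp only [pow_succ (transferMatrix m), Matrix.mul_apply, Finset.sum_mul]
    rw [Finset.sum_comm]
    simp only [mul_assoc, ← Finset.mul_sum]
    -- The eigenvalue depends only on the number of particles, which is the same for every `Z`
    -- reachable from `X`.
    have h : ∀ Z, (transferMatrix m ^ n) X Z * ∑ Y, transferMatrix m Z Y * chordProd Y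
        = modeProd m X.card * ((transferMatrix m ^ n) X Z * chordProd Z) := by
      intro Z
      by_cases hZ : (transferMatrix m ^ n) X Z = 0
      · simp [hZ]
      · rw [card_eq_of_transferMatrix_pow_ne_zero hZ]
        simp only [transferMatrix, Matrix.of_apply]
        rw [sum_stepCount_mul_chordProd]
        ring
    simp only [h, ← Finset.mul_sum, ih]
    ring

/-- Each particle walks down from `x i` and waits once it reaches `y i`. Taking the maximum
preserves strict monotonicity and spread less than `m`, so no collision occurs, not even around the
circle. -/
theorem one_le_transferMatrix_pow_of_lift {c : ℕ} {x y : Fin c → ℤ} (hx : StrictMono x)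
    (hy : StrictMono y) (hxm : ∀ i j, x i < x j + m) (hym : ∀ i j, y i < y j + m)
    (hxy : ∀ i, y i ≤ x i) (n : ℕ) :
    1 ≤ (transferMatrix m ^ n) (Finset.univ.image fun i => (x i : ZMod m))
      (Finset.univ.image fun i => ((max (x i - n) (y i) : ℤ) : ZMod m)) := by
  have hinj : ∀ n : ℕ, Function.Injective fun i => ((max (x i - n) (y i) : ℤ) : ZMod m) := by
    intro n
    refine injective_intCast_of_strictMono (x := fun i => max (x i - n) (y i))
      (fun i j hij => ?_) fun i j => ?_
    · have h1 := hx hij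
      have h2 := hy hij
      simp only
      omega
    · have h1 := hxm i j
      have h2 := hym i j
      omega
  induction n with
  | zero =>
    have : ∀ i, max (x i - (0 : ℕ)) (y i) = x i := fun i => by
      have := hxy i
      simpa using this
    simp only [this, pow_zero, Matrix.one_apply_eq, le_refl]
  | succ n ih =>
    refine le_trans ?_ (transferMatrix_pow_mul_le n 1 _
      (Finset.univ.image fun i => ((max (x i - n) (y i) : ℤ) : ZMod m)) _)
    refine one_le_mul_of_one_le_of_one_le ih ?_
    rw [pow_one, transferMatrix, Matrix.of_apply, Nat.one_le_cast]
    have hs : (fun i => ((max (x i - (n + 1 : ℕ)) (y i) : ℤ) : ZMod m))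
        = moveBack (fun i => ((max (x i - n) (y i) : ℤ) : ZMod m))
          (Finset.univ.filter fun i => x i - n ≤ y i) := by
      funext i
      by_cases h : x i - n ≤ y i
      · have : max (x i - (n + 1 : ℕ)) (y i) = max (x i - n) (y i) := by omega
        simp only [moveBack, Finset.piecewise, Finset.mem_filter, Finset.mem_univ, true_and, h,
          if_true, this]
      · have : max (x i - (n + 1 : ℕ)) (y i) = max (x i - n) (y i) - 1 := by omega
        simp only [moveBack, Finset.piecewise, Finset.mem_filter, Finset.mem_univ, true_and, h,
          if_false, this]
        push_cast
        rfl
    have h2 := hinj (n + 1)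
    rw [hs] at h2 ⊢
    exact stepCount_pos_of_moveBack (hinj n) h2

theorem one_le_transferMatrix_pow {X Y : Finset (ZMod m)} (h : X.card = Y.card) :
    1 ≤ (transferMatrix m ^ (2 * m)) X Y := by
  obtain ⟨x, hx, hx', hX⟩ := exists_strictMono_intCast X
  obtain ⟨y, hy, hy', hY⟩ := exists_strictMono_intCast Y
  generalize X.card = c at x hx hx' hX h
  generalize Y.card = d at y hy hy' hY h
  subst h
  -- Lowering `y` by `m` keeps its residues and puts it below `x`; every distance is then less than
  -- `2 * m`.
  have key := one_le_transferMatrix_pow_of_lift (m := m) (x := x) (y := fun i => y i - m) hx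
    (fun i j hij => sub_lt_sub_right (hy hij) _) (fun i j => by linarith [hx' i, hx' j])
    (fun i j => by linarith [hy' i, hy' j]) (fun i => by linarith [hx' i, hy' i]) (2 * m)
  have h2 : ∀ i, max (x i - (2 * m : ℕ)) (y i - m) = y i - m := fun i => by
    have := hx' i
    have := hy' i
    omega
  simp only [h2] at key
  rw [hX] at key
  simpa [hY] using key

/-- Upper bound for the number of walks starting at `X`. -/
theorem exists_transferMatrix_pow_le (X : Finset (ZMod m)) :
    ∃ C : ℝ, 0 < C ∧ ∀ n Y, (transferMatrix m ^ n) X Y ≤ C * modeProd m X.card ^ n := by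
  obtain ⟨Y₀, -, hY₀⟩ := Finset.exists_min_image Finset.univ (chordProd (m := m))
    Finset.univ_nonempty
  refine ⟨chordProd X / chordProd Y₀, div_pos (chordProd_pos _) (chordProd_pos _), fun n Y => ?_⟩
  rw [div_mul_eq_mul_div, le_div_iff₀ (chordProd_pos _), mul_comm (chordProd X),
    ← sum_transferMatrix_pow_mul_chordProd]
  calc _ ≤ (transferMatrix m ^ n) X Y * chordProd Y :=
        mul_le_mul_of_nonneg_left (hY₀ Y (Finset.mem_univ _)) (transferMatrix_pow_nonneg _ _ _)
    _ ≤ _ := Finset.single_le_sum (f := fun Y => (transferMatrix m ^ n) X Y * chordProd Y)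
        (fun Y _ => mul_nonneg (transferMatrix_pow_nonneg _ _ _) (chordProd_pos _).le)
        (Finset.mem_univ Y)

/-- Lower bound for the number of closed walks at `X`. -/
theorem le_transferMatrix_pow_self (n : ℕ) (X : Finset (ZMod m)) :
    modeProd m X.card ^ n * chordProd X ≤ (transferMatrix m ^ (n + 2 * m)) X X := by
  rw [← sum_transferMatrix_pow_mul_chordProd, pow_add, Matrix.mul_apply]
  -- Since `chordProd Y ≤ 1`, the weight of the endpoint `Y` is dominated by the number of ways back
  -- from `Y` to `X` in `2 * m` steps.
  refine Finset.sum_le_sum fun Y _ => ?_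
  by_cases hY : (transferMatrix m ^ n) X Y = 0
  · simp [hY]
  · exact mul_le_mul_of_nonneg_left ((chordProd_le_one Y).trans
      (one_le_transferMatrix_pow (card_eq_of_transferMatrix_pow_ne_zero hY).symm))
      (transferMatrix_pow_nonneg _ _ _)

end Transfer

/-- A sum over all walks of length `n` is given by the `n`-th power of the matrix. -/
theorem sum_walks_eq_pow {S : Type*} [Fintype S] [DecidableEq S] (T : Matrix S S ℝ) (f g : S → ℝ)
    (n : ℕ) :
    ∑ X : Fin (n + 1) → S, f (X 0) * (∏ j : Fin n, T (X j.castSucc) (X j.succ)) * g (X (Fin.last n))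
      = ∑ s, ∑ t, f s * (T ^ n) s t * g t := by
  induction n generalizing f with
  | zero =>
    rw [← (Equiv.funUnique (Fin 1) S).symm.sum_comp]
    simp [Matrix.one_apply]
  | succ n ih =>
    rw [← (Fin.consEquiv fun _ => S).sum_comp, Fintype.sum_prod_type]
    simp only [Fin.prod_univ_succ, Fin.consEquiv, Equiv.coe_fn_mk, Fin.cons_zero, Fin.cons_succ,
      Fin.castSucc_zero, ← Fin.succ_last, ← Fin.succ_castSucc]
    refine Finset.sum_congr rfl fun s _ => ?_
    -- The first step is absorbed into the initial weight.
    have := ih fun t => f s * T s t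
    simp only [← mul_assoc]
    rw [this, Finset.sum_comm]
    refine Finset.sum_congr rfl fun t _ => ?_
    rw [pow_succ', Matrix.mul_apply, Finset.mul_sum, Finset.sum_mul]
    simp only [mul_assoc]

/-! ### Perfect matchings of the barrel as edge selections. -/

section Barrel

variable {m k : ℕ}

/-- The end of a spoke of layer `i` on the smaller circle. -/
def lowEnd (i : Fin (k + 2)) (l : ZMod m) : BarrelVertex m k :=
  Fin.cases (.inner l) (fun j => .ringOut j l) i

/-- The end of a spoke of layer `i` on the larger circle. -/
def upEnd (i : Fin (k + 2)) (l : ZMod m) : BarrelVertex m k :=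
  Fin.lastCases (.outer l) (fun j => .ringIn j l) i

@[simp] theorem lowEnd_zero (l : ZMod m) : lowEnd (k := k) 0 l = .inner l := rfl

@[simp] theorem lowEnd_succ (j : Fin (k + 1)) (l : ZMod m) : lowEnd j.succ l = .ringOut j l := rfl

@[simp] theorem upEnd_last (l : ZMod m) : upEnd (Fin.last (k + 1)) l = .outer l := by
  simp [upEnd]

@[simp] theorem upEnd_castSucc (j : Fin (k + 1)) (l : ZMod m) :
    upEnd j.castSucc l = .ringIn j l := by
  simp [upEnd]

@[simp] theorem upEnd_zero (l : ZMod m) : upEnd (k := k) 0 l = .ringIn 0 l :=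
  upEnd_castSucc 0 l

@[simp] theorem upEnd_castSucc_succ (j : Fin k) (l : ZMod m) :
    upEnd j.castSucc.succ l = .ringIn j.succ l :=
  upEnd_castSucc j.succ l

@[simp] theorem upEnd_last_succ (l : ZMod m) : upEnd (Fin.last k).succ l = .outer l :=
  upEnd_last l

@[simp] theorem lowEnd_succ_castSucc (j : Fin k) (l : ZMod m) :
    lowEnd j.succ.castSucc l = .ringOut j.castSucc l := rfl

@[simp] theorem lowEnd_last (l : ZMod m) :
    lowEnd (Fin.last (k + 1)) l = .ringOut (Fin.last k) l := rfl

/-- A selection of edges of the barrel: the complements of the selected spokes, the selected edges of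
the inner cycle, of the rings, and of the outer cycle. -/
abbrev Selection (m k : ℕ) : Type :=
  (Fin (k + 2) → Finset (ZMod m)) × Finset (ZMod m) ×
    (Fin (k + 1) → Finset (ZMod m) × Finset (ZMod m)) × Finset (ZMod m)

/-- The selected edges, each with one orientation. -/
def Selection.Rel (d : Selection m k) : BarrelVertex m k → BarrelVertex m k → Prop
  | .inner l, .inner l' => l' = l + 1 ∧ l ∈ d.2.1
  | .inner l, .ringIn j l' => j = 0 ∧ l' = l ∧ l ∉ d.1 0
  | .ringIn j l, .ringOut j' l' => j' = j ∧ l' = l ∧ l ∈ (d.2.2.1 j).1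
  | .ringOut j l, .ringIn j' l' => (j' = j ∧ l' = l + 1 ∧ l ∈ (d.2.2.1 j).2) ∨
      ((j' : ℕ) = j + 1 ∧ l' = l ∧ l ∉ d.1 j.succ)
  | .ringOut j l, .outer l' => j = Fin.last k ∧ l' = l ∧ l ∉ d.1 (Fin.last (k + 1))
  | .outer l, .outer l' => l' = l + 1 ∧ l ∈ d.2.2.2
  | _, _ => False

theorem Selection.Rel.barrelEdge {d : Selection m k} {x y : BarrelVertex m k} (h : d.Rel x y) :
    BarrelEdge m k x y := by
  cases x <;> cases y <;> simp only [Selection.Rel] at h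
  · obtain ⟨rfl, -⟩ := h
    exact .innerCycle _
  · obtain ⟨rfl, rfl, -⟩ := h
    exact .innerSpoke _
  · obtain ⟨rfl, rfl, -⟩ := h
    exact .ringCycle _ _
  · rename_i j l j' l'
    obtain ⟨rfl, rfl, -⟩ | ⟨hj, rfl, -⟩ := h
    · exact .ringCycle' _ _
    · have hjk : (j : ℕ) < k := by have := j'.2; omega
      obtain rfl : j' = (⟨j, hjk⟩ : Fin k).succ := Fin.ext hj
      exact .spoke ⟨j, hjk⟩ _
  · obtain ⟨rfl, rfl, -⟩ := h
    exact .outerSpoke _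
  · obtain ⟨rfl, -⟩ := h
    exact .outerCycle _

theorem ZMod.one_ne_zero_of_three_le (hm : 3 ≤ m) : (1 : ZMod m) ≠ 0 := by
  have : Fact (1 < m) := ⟨by omega⟩
  exact one_ne_zero

theorem ZMod.two_ne_zero_of_three_le (hm : 3 ≤ m) : (2 : ZMod m) ≠ 0 := by
  intro h
  have := (ZMod.natCast_eq_zero_iff 2 m).1 (by exact_mod_cast h)
  exact absurd (Nat.le_of_dvd two_pos this) (by omega)

theorem BarrelEdge.ne (hm : 3 ≤ m) {x y : BarrelVertex m k} (h : BarrelEdge m k x y) : x ≠ y := by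
  have := ZMod.one_ne_zero_of_three_le hm
  cases h <;> simp [this]

theorem barrelFullerene_adj (hm : 3 ≤ m) {x y : BarrelVertex m k} :
    (barrelFullerene m k).Adj x y ↔ BarrelEdge m k x y ∨ BarrelEdge m k y x := by
  rw [barrelFullerene, SimpleGraph.fromRel_adj]
  exact and_iff_right_of_imp fun h => h.elim (·.ne hm) fun h => (h.ne hm).symm

/-- The spanning subgraph of the selected edges. -/
def Selection.toSubgraph (hm : 3 ≤ m) (d : Selection m k) : (barrelFullerene m k).Subgraph where
  verts := Set.univ
  Adj x y := d.Rel x y ∨ d.Rel y x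
  adj_sub h := (barrelFullerene_adj hm).2 (h.imp (·.barrelEdge) (·.barrelEdge))
  edge_vert _ := Set.mem_univ _
  symm := ⟨fun _ _ h => h.symm⟩

open Classical in
/-- The edges selected by a subgraph. -/
noncomputable def subgraphSelection [NeZero m] (M : (barrelFullerene m k).Subgraph) :
    Selection m k :=
  (fun i => {l | ¬ M.Adj (lowEnd i l) (upEnd i l)}, ({l | M.Adj (.inner l) (.inner (l + 1))} : Finset _),
    fun j => (({l | M.Adj (.ringIn j l) (.ringOut j l)} : Finset _),
      ({l | M.Adj (.ringOut j l) (.ringIn j (l + 1))} : Finset _)),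
    ({l | M.Adj (.outer l) (.outer (l + 1))} : Finset _))

section Membership

variable [NeZero m] {M : (barrelFullerene m k).Subgraph} {l : ZMod m}

theorem mem_subgraphSelection_spoke {i : Fin (k + 2)} :
    l ∈ (subgraphSelection M).1 i ↔ ¬ M.Adj (lowEnd i l) (upEnd i l) := by
  simp [subgraphSelection]

theorem mem_subgraphSelection_inner :
    l ∈ (subgraphSelection M).2.1 ↔ M.Adj (.inner l) (.inner (l + 1)) := by
  simp [subgraphSelection]

theorem mem_subgraphSelection_ring {j : Fin (k + 1)} :
    l ∈ ((subgraphSelection M).2.2.1 j).1 ↔ M.Adj (.ringIn j l) (.ringOut j l) := by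
  simp [subgraphSelection]

theorem mem_subgraphSelection_ring' {j : Fin (k + 1)} :
    l ∈ ((subgraphSelection M).2.2.1 j).2 ↔ M.Adj (.ringOut j l) (.ringIn j (l + 1)) := by
  simp [subgraphSelection]

theorem mem_subgraphSelection_outer :
    l ∈ (subgraphSelection M).2.2.2 ↔ M.Adj (.outer l) (.outer (l + 1)) := by
  simp [subgraphSelection]

end Membership

theorem subgraphSelection_toSubgraph [NeZero m] (hm : 3 ≤ m) (d : Selection m k) :
    subgraphSelection (d.toSubgraph hm) = d := by
  -- If `2` vanished, the cap edges from `l` to `l + 1` and from `l + 1` to `l + 2` would coincide,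
  -- and the selection could not be recovered.
  have h2 := ZMod.two_ne_zero_of_three_le hm
  have h2' : ∀ l : ZMod m, l ≠ l + 1 + 1 := fun l h => h2 (by linear_combination -h)
  have h1 := ZMod.one_ne_zero_of_three_le hm
  refine Prod.ext (funext fun i => ?_) (Prod.ext ?_ (Prod.ext (funext fun j => Prod.ext ?_ ?_) ?_))
  · ext l
    rw [mem_subgraphSelection_spoke]
    induction i using Fin.cases with
    | zero => simp [Selection.toSubgraph, Selection.Rel]
    | succ j =>
      induction j using Fin.lastCases with
      | last => simp [Selection.toSubgraph, Selection.Rel]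
      | cast j =>
        have hj : j.succ ≠ j.castSucc := fun h => by simpa using congrArg Fin.val h
        rw [lowEnd_succ, upEnd_castSucc_succ]
        simp [Selection.toSubgraph, Selection.Rel, hj, hj.symm]
  · ext l
    rw [mem_subgraphSelection_inner]
    simp [Selection.toSubgraph, Selection.Rel, h2']
  · ext l
    rw [mem_subgraphSelection_ring]
    simp [Selection.toSubgraph, Selection.Rel, h1]
  · ext l
    rw [mem_subgraphSelection_ring']
    simp [Selection.toSubgraph, Selection.Rel, h1]
  · ext l
    rw [mem_subgraphSelection_outer]
    simp [Selection.toSubgraph, Selection.Rel, h2']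

theorem subgraphSelection_rel [NeZero m] {M : (barrelFullerene m k).Subgraph}
    {x y : BarrelVertex m k} (hxy : BarrelEdge m k x y) :
    (subgraphSelection M).Rel x y ↔ M.Adj x y := by
  cases hxy with
  | innerCycle l => simp [Selection.Rel, mem_subgraphSelection_inner]
  | ringCycle j l => simp [Selection.Rel, mem_subgraphSelection_ring]
  | ringCycle' j l => simp [Selection.Rel, mem_subgraphSelection_ring']
  | outerCycle l => simp [Selection.Rel, mem_subgraphSelection_outer]
  | innerSpoke l => simp [Selection.Rel, mem_subgraphSelection_spoke]
  | spoke j l =>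
    have hj : j.succ ≠ j.castSucc := fun h => by simpa using congrArg Fin.val h
    simp only [Selection.Rel, mem_subgraphSelection_spoke, upEnd_castSucc_succ, lowEnd_succ]
    simp [hj]
  | outerSpoke l => simp [Selection.Rel, mem_subgraphSelection_spoke]

theorem toSubgraph_subgraphSelection [NeZero m] (hm : 3 ≤ m)
    {M : (barrelFullerene m k).Subgraph} (hM : M.IsSpanning) :
    (subgraphSelection M).toSubgraph hm = M := by
  refine SimpleGraph.Subgraph.ext (Set.eq_univ_of_forall hM).symm ?_
  ext x y
  change (_ ∨ _) ↔ _
  constructor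
  · rintro (h | h)
    · exact (subgraphSelection_rel h.barrelEdge).1 h
    · exact ((subgraphSelection_rel h.barrelEdge).1 h).symm
  · intro h
    rcases (barrelFullerene_adj hm).1 h.adj_sub with e | e
    · exact .inl ((subgraphSelection_rel e).2 h)
    · exact .inr ((subgraphSelection_rel e).2 h.symm)

/-- The local conditions saying that a selection is a perfect matching. -/
def Selection.IsPerfect (d : Selection m k) : Prop :=
  IsCap (d.1 0) d.2.1 ∧
    (∀ j : Fin (k + 1), IsStep (d.1 j.castSucc) (d.1 j.succ) (d.2.2.1 j).1 (d.2.2.1 j).2) ∧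
    IsCap (d.1 (Fin.last (k + 1))) d.2.2.2

/-- Applied with `a` across the spoke and `b`, `c` along the cycle. The two clauses on the right are
those of `IsCap` and `IsStep` at a vertex. -/
theorem existsUnique_iff_of_three {V : Type*} {R : V → Prop} {a b c : V} (hab : a ≠ b)
    (hac : a ≠ c) (hbc : b ≠ c) (h : ∀ w, R w → w = a ∨ w = b ∨ w = c) :
    (∃! w, R w) ↔ (¬ R a ↔ R b ∨ R c) ∧ ¬ (R b ∧ R c) := by
  constructor
  · rintro ⟨w, hw, hu⟩
    have hu' : ∀ y z, R y → R z → y = z := fun y z hy hz => (hu y hy).trans (hu z hz).symm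
    have h1 := fun p q => hab (hu' a b p q)
    have h2 := fun p q => hac (hu' a c p q)
    have h3 := fun p q => hbc (hu' b c p q)
    rcases h w hw with rfl | rfl | rfl <;> tauto
  · rintro ⟨h1, h2⟩
    by_cases ha : R a
    · refine ⟨a, ha, fun y hy => ?_⟩
      rcases h y hy with rfl | rfl | rfl <;> tauto
    · rcases h1.1 ha with hb | hc
      · refine ⟨b, hb, fun y hy => ?_⟩
        rcases h y hy with rfl | rfl | rfl <;> tauto
      · refine ⟨c, hc, fun y hy => ?_⟩
        rcases h y hy with rfl | rfl | rfl <;> tauto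

theorem barrelFullerene_adj_inner (hm : 3 ≤ m) {l : ZMod m} {w : BarrelVertex m k}
    (h : (barrelFullerene m k).Adj (.inner l) w) :
    w = upEnd 0 l ∨ w = .inner (l + 1) ∨ w = .inner (l - 1) := by
  rcases (barrelFullerene_adj hm).1 h with h | h <;> cases h <;> simp

theorem barrelFullerene_adj_outer (hm : 3 ≤ m) {l : ZMod m} {w : BarrelVertex m k}
    (h : (barrelFullerene m k).Adj (.outer l) w) :
    w = lowEnd (Fin.last (k + 1)) l ∨ w = .outer (l + 1) ∨ w = .outer (l - 1) := by
  rcases (barrelFullerene_adj hm).1 h with h | h <;> cases h <;> simp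

theorem barrelFullerene_adj_ringIn (hm : 3 ≤ m) {j : Fin (k + 1)} {l : ZMod m}
    {w : BarrelVertex m k} (h : (barrelFullerene m k).Adj (.ringIn j l) w) :
    w = lowEnd j.castSucc l ∨ w = .ringOut j l ∨ w = .ringOut j (l - 1) := by
  rcases (barrelFullerene_adj hm).1 h with h | h <;> cases h <;>
    simp only [lowEnd_succ_castSucc, Fin.castSucc_zero, lowEnd_zero, add_sub_cancel_right, true_or,
      or_true]

theorem barrelFullerene_adj_ringOut (hm : 3 ≤ m) {j : Fin (k + 1)} {l : ZMod m}
    {w : BarrelVertex m k} (h : (barrelFullerene m k).Adj (.ringOut j l) w) :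
    w = upEnd j.succ l ∨ w = .ringIn j l ∨ w = .ringIn j (l + 1) := by
  rcases (barrelFullerene_adj hm).1 h with h | h <;> cases h <;>
    simp only [upEnd_castSucc_succ, upEnd_last_succ, true_or, or_true]

theorem lowEnd_castSucc_ne (j : Fin (k + 1)) (l l' : ZMod m) :
    lowEnd j.castSucc l ≠ .ringOut j l' := by
  induction j using Fin.cases with
  | zero => simp
  | succ j =>
    rw [lowEnd_succ_castSucc]
    exact fun h => by simpa using congrArg Fin.val (BarrelVertex.ringOut.inj h).1

theorem upEnd_succ_ne (j : Fin (k + 1)) (l l' : ZMod m) : upEnd j.succ l ≠ .ringIn j l' := by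
  induction j using Fin.lastCases with
  | last => simp
  | cast j =>
    rw [upEnd_castSucc_succ]
    exact fun h => by simpa using congrArg Fin.val (BarrelVertex.ringIn.inj h).1

theorem isPerfectMatching_iff_subgraphSelection [NeZero m] (hm : 3 ≤ m)
    {M : (barrelFullerene m k).Subgraph} :
    M.IsPerfectMatching ↔ (subgraphSelection M).IsPerfect := by
  have h1 := ZMod.one_ne_zero_of_three_le hm
  have h2 : ∀ l : ZMod m, l + 1 ≠ l - 1 := fun l h =>
    ZMod.two_ne_zero_of_three_le hm (by linear_combination h)
  have h3 : ∀ l : ZMod m, l ≠ l - 1 := fun l h => h1 (by linear_combination h)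
  have h4 : ∀ l : ZMod m, l ≠ l + 1 := fun l h => h1 (by linear_combination -h)
  have hin : ∀ l, (∃! w, M.Adj (.inner l) w) ↔ _ := fun l =>
    existsUnique_iff_of_three (by simp) (by simp) (by simpa using h2 l)
      fun w hw => barrelFullerene_adj_inner hm hw.adj_sub
  have hout : ∀ l, (∃! w, M.Adj (.outer l) w) ↔ _ := fun l =>
    existsUnique_iff_of_three (by simp) (by simp) (by simpa using h2 l)
      fun w hw => barrelFullerene_adj_outer hm hw.adj_sub
  have hrin : ∀ j l, (∃! w, M.Adj (.ringIn j l) w) ↔ _ := fun j l =>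
    existsUnique_iff_of_three (lowEnd_castSucc_ne j l _) (lowEnd_castSucc_ne j l _)
      (by simpa using h3 l) fun w hw => barrelFullerene_adj_ringIn hm hw.adj_sub
  have hrout : ∀ j l, (∃! w, M.Adj (.ringOut j l) w) ↔ _ := fun j l =>
    existsUnique_iff_of_three (upEnd_succ_ne j l _) (upEnd_succ_ne j l _)
      (by simpa using h4 l) fun w hw => barrelFullerene_adj_ringOut hm hw.adj_sub
  rw [SimpleGraph.Subgraph.isPerfectMatching_iff]
  have hv : (∀ v, ∃! w, M.Adj v w) ↔ (∀ l, ∃! w, M.Adj (.inner l) w) ∧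
      (∀ j, (∀ l, ∃! w, M.Adj (.ringIn j l) w) ∧ ∀ l, ∃! w, M.Adj (.ringOut j l) w) ∧
      ∀ l, ∃! w, M.Adj (.outer l) w :=
    ⟨fun h => ⟨fun _ => h _, fun _ => ⟨fun _ => h _, fun _ => h _⟩, fun _ => h _⟩,
      fun ⟨ha, hb, hc⟩ v => by
        cases v
        exacts [ha _, (hb _).1 _, (hb _).2 _, hc _]⟩
  have e1 : ∀ l, M.Adj (.inner l) (.inner (l - 1)) ↔ M.Adj (.inner (l - 1)) (.inner l) :=
    fun _ => M.adj_comm _ _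
  have e2 : ∀ l, M.Adj (.outer l) (.outer (l - 1)) ↔ M.Adj (.outer (l - 1)) (.outer l) :=
    fun _ => M.adj_comm _ _
  have e3 : ∀ j l, M.Adj (.ringIn j l) (.ringOut j (l - 1)) ↔
      M.Adj (.ringOut j (l - 1)) (.ringIn j l) := fun _ _ => M.adj_comm _ _
  have e4 : ∀ j l, M.Adj (.ringOut j l) (.ringIn j l) ↔ M.Adj (.ringIn j l) (.ringOut j l) :=
    fun _ _ => M.adj_comm _ _
  have e5 : ∀ l, M.Adj (.outer l) (lowEnd (Fin.last (k + 1)) l) ↔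
      M.Adj (lowEnd (Fin.last (k + 1)) l) (.outer l) := fun _ => M.adj_comm _ _
  have e6 : ∀ j l, M.Adj (.ringIn j l) (lowEnd j.castSucc l) ↔
      M.Adj (lowEnd j.castSucc l) (.ringIn j l) := fun _ _ => M.adj_comm _ _
  rw [hv]
  simp only [hin, hout, hrin, hrout, Selection.IsPerfect, IsCap, IsStep, mem_subgraphSelection_spoke,
    mem_subgraphSelection_inner, mem_subgraphSelection_outer, mem_subgraphSelection_ring,
    mem_subgraphSelection_ring', forall_and, sub_add_cancel, lowEnd_zero, upEnd_last, upEnd_castSucc,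
    lowEnd_succ, e1, e2, e3, e4, e5, e6]
  tauto

end Barrel

/-- Perfect matchings of the barrel decompose into states, caps and steps. -/
noncomputable def perfectMatchingEquiv {m k : ℕ} [NeZero m] (hm : 3 ≤ m) :
    {M : (barrelFullerene m k).Subgraph // M.IsPerfectMatching} ≃
      Σ X : Fin (k + 2) → Finset (ZMod m), {P // IsCap (X 0) P} ×
        ((j : Fin (k + 1)) → {E : Finset (ZMod m) × Finset (ZMod m) //
          IsStep (X j.castSucc) (X j.succ) E.1 E.2}) × {Q // IsCap (X (Fin.last (k + 1))) Q} :=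
  Equiv.trans (β := {d : Selection m k // d.IsPerfect})
    { toFun := fun M =>
        ⟨subgraphSelection M.1, (isPerfectMatching_iff_subgraphSelection hm).1 M.2⟩
      invFun := fun d => ⟨d.1.toSubgraph hm, (isPerfectMatching_iff_subgraphSelection hm).2
        ((subgraphSelection_toSubgraph hm d.1).symm ▸ d.2)⟩
      left_inv := fun M => Subtype.ext (toSubgraph_subgraphSelection hm M.2.2)
      right_inv := fun d => Subtype.ext (subgraphSelection_toSubgraph hm d.1) }
    { toFun := fun d => ⟨d.1.1, ⟨d.1.2.1, d.2.1⟩, fun j => ⟨d.1.2.2.1 j, d.2.2.1 j⟩,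
        ⟨d.1.2.2.2, d.2.2.2⟩⟩
      invFun := fun d => ⟨(d.1, d.2.1.1, fun j => (d.2.2.1 j).1, d.2.2.2.1),
        d.2.1.2, fun j => (d.2.2.1 j).2, d.2.2.2.2⟩
      left_inv := fun _ => rfl
      right_inv := fun _ => rfl }

theorem numPerfectMatchings_eq_sum {m k : ℕ} [NeZero m] (hm : 3 ≤ m) :
    (numPerfectMatchings (barrelFullerene m k) : ℝ) = ∑ X : Finset (ZMod m), ∑ Y : Finset (ZMod m),
      (capCount X : ℝ) * (transferMatrix m ^ (k + 1)) X Y * capCount Y := by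
  classical
  rw [← sum_walks_eq_pow, numPerfectMatchings, Nat.card_congr (perfectMatchingEquiv hm),
    Nat.card_sigma]
  simp only [Nat.card_prod, Nat.card_pi]
  push_cast
  refine Finset.sum_congr rfl fun X _ => ?_
  simp only [capCount, transferMatrix, Matrix.of_apply, stepCount, mul_assoc]

/-! ### The optimal even number of particles. -/

theorem modeProd_two_mul (m p : ℕ) :
    modeProd m (2 * p)
      = ∏ j ∈ Finset.range p, (2 * Real.cos (Real.pi * (2 * j + 1) / (2 * m))) ^ 2 := by
  have h0 : modeProd m (2 * p) = ∏ j ∈ Finset.range (p + p),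
      2 * Real.cos (Real.pi * (2 * (j : ℝ) - (2 * p - 1)) / (2 * m)) := by
    rw [← two_mul, ← Fin.prod_univ_eq_prod_range
      (fun j : ℕ => 2 * Real.cos (Real.pi * (2 * (j : ℝ) - (2 * p - 1)) / (2 * m)))]
    refine Finset.prod_congr rfl fun j _ => ?_
    simp only [modeAngle, div_div]
    push_cast
    rw [mul_comm (m : ℝ)]
  -- The lower half of the modes, reflected, is the negative of the upper half; as cosine is even,
  -- the factors pair into squares.
  rw [h0, Finset.prod_range_add, ← Finset.prod_range_reflect]
  simp only [sq, Finset.prod_mul_distrib (f := fun j : ℕ =>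
    2 * Real.cos (Real.pi * (2 * (j : ℝ) + 1) / (2 * m)))]
  congr 1
  · refine Finset.prod_congr rfl fun j hj => ?_
    have hj' := Finset.mem_range.1 hj
    rw [show p - 1 - j = p - (j + 1) by omega, Nat.cast_sub hj', ← Real.cos_neg]
    push_cast
    congr 2
    ring
  · refine Finset.prod_congr rfl fun j _ => ?_
    push_cast
    congr 2
    ring

theorem prod_Icc_eq_modeProd (m p : ℕ) :
    (∏ j ∈ Finset.Icc 1 p, (2 * Real.cos (Real.pi * (2 * (j : ℝ) - 1) / (2 * (m : ℝ)))) ^ 2)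
      = modeProd m (2 * p) := by
  rw [modeProd_two_mul]
  induction p with
  | zero => simp
  | succ p ih =>
    rw [Finset.prod_Icc_succ_top (by omega), Finset.prod_range_succ, ih]
    push_cast
    congr 5
    ring

/-- The factor reaches `1` when the angle is at most `π / 3`, i.e. `3 * (2 * j + 1) ≤ 2 * m`; for
integers this is `j < (m + 1) / 3`. -/
theorem one_le_mode_sq {m j : ℕ} (hm : 0 < m) (hj : j < (m + 1) / 3) :
    1 ≤ (2 * Real.cos (Real.pi * (2 * j + 1) / (2 * m))) ^ 2 := by
  have hm' : (0 : ℝ) < m := Nat.cast_pos.2 hm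
  have h1 : (3 * (2 * j + 1) : ℝ) ≤ 2 * m := by
    have : 3 * (2 * j + 1) ≤ 2 * m := by omega
    exact_mod_cast this
  have h2 : Real.cos (Real.pi / 3) ≤ Real.cos (Real.pi * (2 * j + 1) / (2 * m)) := by
    refine Real.cos_le_cos_of_nonneg_of_le_pi (by positivity) (by linarith [Real.pi_pos]) ?_
    rw [div_le_div_iff₀ (by positivity) (by norm_num)]
    have := mul_le_mul_of_nonneg_left h1 Real.pi_pos.le
    linarith
  rw [Real.cos_pi_div_three] at h2
  exact one_le_pow₀ (by linarith)

theorem mode_sq_le_one {m j : ℕ} (hj : (m + 1) / 3 ≤ j) (hjm : 2 * (j + 1) ≤ m) :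
    (2 * Real.cos (Real.pi * (2 * j + 1) / (2 * m))) ^ 2 ≤ 1 := by
  have hm' : (0 : ℝ) < m := Nat.cast_pos.2 (by omega)
  have h1 : (2 * m : ℝ) ≤ 3 * (2 * j + 1) := by
    have : 2 * m ≤ 3 * (2 * j + 1) := by omega
    exact_mod_cast this
  have h3 : (2 * j + 1 : ℝ) ≤ m := by
    have : 2 * j + 1 ≤ m := by omega
    exact_mod_cast this
  have h4 : Real.pi * (2 * j + 1) / (2 * m) ≤ Real.pi / 2 := by
    rw [div_le_div_iff₀ (by positivity) (by norm_num)]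
    have := mul_le_mul_of_nonneg_left h3 Real.pi_pos.le
    linarith
  have h5 : 0 ≤ Real.pi * (2 * j + 1) / (2 * m) := by positivity
  have h2 : Real.cos (Real.pi * (2 * j + 1) / (2 * m)) ≤ Real.cos (Real.pi / 3) := by
    refine Real.cos_le_cos_of_nonneg_of_le_pi (by positivity) (by linarith [Real.pi_pos]) ?_
    rw [div_le_div_iff₀ (by norm_num) (by positivity)]
    have := mul_le_mul_of_nonneg_left h1 Real.pi_pos.le
    linarith
  rw [Real.cos_pi_div_three] at h2
  -- Squaring needs a nonnegative cosine; `2 * (j + 1) ≤ m` keeps the angle below `π / 2`.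
  have h6 := Real.cos_nonneg_of_neg_pi_div_two_le_of_le (by linarith [Real.pi_pos]) h4
  exact pow_le_one₀ (by linarith) (by linarith)

theorem modeProd_two_mul_nonneg (m p : ℕ) : 0 ≤ modeProd m (2 * p) := by
  rw [modeProd_two_mul]
  exact Finset.prod_nonneg fun _ _ => sq_nonneg _

theorem one_le_modeProd {m : ℕ} (hm : 0 < m) : 1 ≤ modeProd m (2 * ((m + 1) / 3)) := by
  rw [modeProd_two_mul]
  exact Finset.one_le_prod fun j hj => one_le_mode_sq hm (Finset.mem_range.1 hj)

theorem modeProd_le {m p : ℕ} (hm : 0 < m) (hp : 2 * p ≤ m) :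
    modeProd m (2 * p) ≤ modeProd m (2 * ((m + 1) / 3)) := by
  rw [modeProd_two_mul, modeProd_two_mul]
  rcases le_total p ((m + 1) / 3) with h | h
  · rw [← Finset.prod_range_mul_prod_Ico _ h]
    refine le_mul_of_one_le_right (Finset.prod_nonneg fun _ _ => sq_nonneg _) ?_
    exact Finset.one_le_prod fun j hj => one_le_mode_sq hm (Finset.mem_Ico.1 hj).2
  · rw [← Finset.prod_range_mul_prod_Ico _ h]
    refine mul_le_of_le_one_right (Finset.prod_nonneg fun _ _ => sq_nonneg _) ?_
    refine Finset.prod_le_one (fun _ _ => sq_nonneg _) fun j hj => ?_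
    obtain ⟨h1, h2⟩ := Finset.mem_Ico.1 hj
    exact mode_sq_le_one h1 (by omega)

/-- The witness is the arc `0, …, 2 * p - 1`, matched by its edges starting at even positions. -/
theorem exists_capCount_pos {m p : ℕ} [NeZero m] (hp : 2 * p ≤ m) :
    ∃ X : Finset (ZMod m), X.card = 2 * p ∧ 0 < capCount X := by
  classical
  have hinj : ∀ a b : ℕ, a < 2 * p → b < 2 * p → (a : ZMod m) = b → a = b := fun a b ha hb h =>
    Nat.ModEq.eq_of_lt_of_lt ((ZMod.natCast_eq_natCast_iff _ _ _).1 h) (by omega) (by omega)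
  refine ⟨(Finset.range (2 * p)).image fun i : ℕ => (i : ZMod m), ?_, ?_⟩
  · rw [Finset.card_image_of_injOn, Finset.card_range]
    intro a ha b hb h
    exact hinj a b (by simpa using ha) (by simpa using hb) h
  · refine Nat.card_pos_iff.2
      ⟨⟨⟨(Finset.range p).image fun i : ℕ => ((2 * i : ℕ) : ZMod m), ?_, ?_⟩⟩, inferInstance⟩
    · intro l
      simp only [Finset.mem_image, Finset.mem_range]
      constructor
      · rintro ⟨a, ha, rfl⟩
        rcases Nat.even_or_odd' a with ⟨i, rfl | rfl⟩
        · exact .inl ⟨i, by omega, rfl⟩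
        · exact .inr ⟨i, by omega, by push_cast; ring⟩
      · rintro (⟨i, hi, rfl⟩ | ⟨i, hi, h⟩)
        · exact ⟨2 * i, by omega, rfl⟩
        · exact ⟨2 * i + 1, by omega, by rw [Nat.cast_succ, h]; ring⟩
    · intro l
      simp only [Finset.mem_image, Finset.mem_range]
      rintro ⟨⟨i, hi, rfl⟩, ⟨j, hj, h⟩⟩
      have := hinj (2 * i) (2 * j + 1) (by omega) (by omega) (by rw [Nat.cast_succ, h]; ring)
      omega

/-! ### Two-sided bounds and the limit. -/

theorem exists_numPerfectMatchings_le {m : ℕ} (hm : 3 ≤ m) :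
    ∃ B : ℝ, 0 < B ∧ ∀ k, (numPerfectMatchings (barrelFullerene m k) : ℝ)
      ≤ B * modeProd m (2 * ((m + 1) / 3)) ^ k := by
  have : NeZero m := ⟨by omega⟩
  choose C hC0 hC using exists_transferMatrix_pow_le (m := m)
  set ρ := modeProd m (2 * ((m + 1) / 3)) with hρ
  have hρ1 : 1 ≤ ρ := one_le_modeProd (by omega)
  let B : ℝ := ∑ X : Finset (ZMod m), ∑ Y : Finset (ZMod m), (capCount X : ℝ) * C X * capCount Y
  have hB : 0 ≤ B := Finset.sum_nonneg fun X _ => Finset.sum_nonneg fun Y _ =>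
    mul_nonneg (mul_nonneg (Nat.cast_nonneg _) (hC0 X).le) (Nat.cast_nonneg _)
  -- Adding `1` makes the constant positive; the factor `ρ` accounts for `k + 1` rings.
  refine ⟨(B + 1) * ρ, by positivity, fun k => ?_⟩
  calc (numPerfectMatchings (barrelFullerene m k) : ℝ)
      = ∑ X : Finset (ZMod m), ∑ Y : Finset (ZMod m),
        (capCount X : ℝ) * (transferMatrix m ^ (k + 1)) X Y * capCount Y :=
        numPerfectMatchings_eq_sum hm
    _ ≤ ∑ X : Finset (ZMod m), ∑ Y : Finset (ZMod m),
        ((capCount X : ℝ) * C X * capCount Y) * ρ ^ (k + 1) := by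
      refine Finset.sum_le_sum fun X _ => Finset.sum_le_sum fun Y _ => ?_
      by_cases hX : capCount X = 0
      · simp [hX]
      obtain ⟨p, hp⟩ := even_iff_two_dvd.1 (even_card_of_capCount_ne_zero hX)
      have hpm : 2 * p ≤ m := by
        rw [← hp]
        exact (Finset.card_le_univ X).trans (ZMod.card m).le
      have h1 : (transferMatrix m ^ (k + 1)) X Y ≤ C X * ρ ^ (k + 1) := by
        refine (hC X (k + 1) Y).trans (mul_le_mul_of_nonneg_left ?_ (hC0 X).le)
        rw [hp]
        exact pow_le_pow_left₀ (modeProd_two_mul_nonneg m p) (modeProd_le (by omega) hpm) _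
      have h2 := mul_le_mul_of_nonneg_right
        (mul_le_mul_of_nonneg_left h1 (Nat.cast_nonneg (α := ℝ) (capCount X)))
        (Nat.cast_nonneg (α := ℝ) (capCount Y))
      linarith
    _ = B * ρ ^ (k + 1) := by simp only [B, Finset.sum_mul]
    _ ≤ (B + 1) * ρ * ρ ^ k := by
      rw [pow_succ', ← mul_assoc]
      gcongr
      linarith

theorem exists_le_numPerfectMatchings {m : ℕ} (hm : 3 ≤ m) :
    ∃ A : ℝ, 0 < A ∧ ∀ k, 2 * m ≤ k → A * modeProd m (2 * ((m + 1) / 3)) ^ k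
      ≤ (numPerfectMatchings (barrelFullerene m k) : ℝ) := by
  have : NeZero m := ⟨by omega⟩
  obtain ⟨X, hX, hcap⟩ := exists_capCount_pos (m := m) (p := (m + 1) / 3) (by omega)
  set ρ := modeProd m (2 * ((m + 1) / 3)) with hρ
  have hρ1 : 1 ≤ ρ := one_le_modeProd (by omega)
  have hρ0 : 0 < ρ := by linarith
  -- Dividing by `ρ ^ (2 * m)` pays for the steps spent returning to `X`.
  refine ⟨chordProd X / ρ ^ (2 * m), div_pos (chordProd_pos X) (by positivity), fun k hk => ?_⟩
  have hc : (1 : ℝ) ≤ capCount X := Nat.one_le_cast.2 hcap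
  have hT := transferMatrix_pow_nonneg (k + 1) X X
  have hterm : ∀ X Y : Finset (ZMod m),
      0 ≤ (capCount X : ℝ) * (transferMatrix m ^ (k + 1)) X Y * capCount Y := fun X Y =>
    mul_nonneg (mul_nonneg (Nat.cast_nonneg _) (transferMatrix_pow_nonneg _ _ _))
      (Nat.cast_nonneg _)
  calc chordProd X / ρ ^ (2 * m) * ρ ^ k = ρ ^ (k - 2 * m) * chordProd X := by
        rw [pow_sub₀ _ hρ0.ne' hk]
        ring
    _ ≤ ρ ^ (k + 1 - 2 * m) * chordProd X := by
        have := chordProd_pos X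
        exact mul_le_mul_of_nonneg_right (pow_le_pow_right₀ hρ1 (by omega)) this.le
    _ ≤ (transferMatrix m ^ (k + 1)) X X := by
        have := le_transferMatrix_pow_self (k + 1 - 2 * m) X
        rwa [hX, Nat.sub_add_cancel (by omega)] at this
    _ ≤ (capCount X : ℝ) * (transferMatrix m ^ (k + 1)) X X * capCount X :=
        (le_mul_of_one_le_left hT hc).trans (le_mul_of_one_le_right (by positivity) hc)
    _ ≤ ∑ Y, (capCount X : ℝ) * (transferMatrix m ^ (k + 1)) X Y * capCount Y :=
        Finset.single_le_sum
          (f := fun Y => (capCount X : ℝ) * (transferMatrix m ^ (k + 1)) X Y * capCount Y)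
          (fun Y _ => hterm X Y) (Finset.mem_univ X)
    _ ≤ _ := Finset.single_le_sum
          (f := fun X => ∑ Y, (capCount X : ℝ) * (transferMatrix m ^ (k + 1)) X Y * capCount Y)
          (fun X _ => Finset.sum_nonneg fun Y _ => hterm X Y) (Finset.mem_univ X)
    _ = _ := (numPerfectMatchings_eq_sum hm).symm

theorem tendsto_const_mul_pow_rpow {A ρ : ℝ} (hA : 0 < A) (hρ : 0 ≤ ρ) :
    Filter.Tendsto (fun k : ℕ => (A * ρ ^ k) ^ (1 / (k : ℝ))) Filter.atTop (nhds ρ) := by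
  have h : Filter.Tendsto (fun k : ℕ => A ^ (1 / (k : ℝ)) * ρ) Filter.atTop (nhds (A ^ (0 : ℝ) * ρ)) :=
    (tendsto_const_nhds.rpow tendsto_one_div_atTop_nhds_zero_nat (.inl hA.ne')).mul_const ρ
  rw [Real.rpow_zero, one_mul] at h
  refine h.congr' ?_
  -- At `k = 0` the exponent `1 / k` is `0` by convention, so the root identity needs `k ≥ 1`.
  filter_upwards [Filter.eventually_ge_atTop 1] with k hk
  rw [Real.mul_rpow hA.le (pow_nonneg hρ k), one_div, Real.pow_rpow_inv_natCast hρ (by omega)]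

theorem mainTheorem1 (m : ℕ) (hm : 3 ≤ m) :
    Filter.Tendsto
      (fun k : ℕ => (numPerfectMatchings (barrelFullerene m k) : ℝ) ^ (1 / (k : ℝ)))
      Filter.atTop
      (nhds (∏ j ∈ Finset.Icc 1 ((m + 1) / 3),
        (2 * Real.cos (Real.pi * (2 * (j : ℝ) - 1) / (2 * (m : ℝ)))) ^ 2)) := by
  rw [prod_Icc_eq_modeProd]
  obtain ⟨A, hA, hlow⟩ := exists_le_numPerfectMatchings hm
  obtain ⟨B, hB, hup⟩ := exists_numPerfectMatchings_le hm
  have hρ := modeProd_two_mul_nonneg m ((m + 1) / 3)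
  refine tendsto_of_tendsto_of_tendsto_of_le_of_le' (tendsto_const_mul_pow_rpow hA hρ)
    (tendsto_const_mul_pow_rpow hB hρ) ?_ (.of_forall fun k => ?_)
  · filter_upwards [Filter.eventually_ge_atTop (2 * m)] with k hk
    exact Real.rpow_le_rpow (by positivity) (hlow k hk) (by positivity)
  · exact Real.rpow_le_rpow (by positivity) (hup k) (by positivity)
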